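/- Let $G$ be a locally compact group and let $A$ be a locally $C^*$-algebra, i.e. a complete Hausdorff complex topological $*$-algebra whose topology is determined by $C^*$-seminorms (a unit is not assumed). Let $S(A)$ be the set of continuous $C^*$-seminorms on $A$, and let $C_b(G,A)$ be the $*$-algebra of continuous functions $F:G\to A$ with $\|F\|_p=\sup_{t\in G}p(F(t))<\infty$ for all $p\in S(A)$, with the topology given by the seminorms $\|\cdot\|_p$; it is identified with $M(A,C_0(G))\subseteq M(A\otimes C_0(G))$, where $A\otimes C_0(G)=C_0(G,A)$. An action of the commutative Kac $C^*$-algebra $C^*\mathbf K_G^a=(C_0(G),d,j,ds)$, $d(f)(s,t)=f(st)$, on $A$ is an injective continuous $*$-morphism $\alpha:A\to C_b(G,A)$ such that * for every approximate unit $(e_i)$ of $A$ (an increasing net of positive elements with $p(e_i)\le 1$ for all $p\in S(A)$ and $e_ia\to a$, $ae_i\to a$ for all $a\in A$), $\alpha(e_i)\to 1$ strictly, i.e. $\alpha(e_i)h\to h$ and $h\alpha(e_i)\to h$ for all $h\in C_0(G,A)$; * $(\overline{\alpha\otimes\mathrm{id}})\circ\alpha=(\overline{\mathrm{id}_A\otimes(\sigma\circ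 d)})\circ\alpha$ with $\sigma$ the flip, i.e. $\alpha(\alpha(a)(t))(s)=\alpha(a)(ts)$ for all $a\in A$, $s,t\in G$. It is an inverse limit action if $A$ can be written as an inverse limit $\varprojlim_{\delta\in\Delta}A_\delta$ of $C^*$-algebras over a directed set in such a way that there are actions $\alpha^{(\delta)}$ of $C^*\mathbf K_G^a$ on $A_\delta$ forming an inverse system with $\alpha=\varprojlim_\delta\alpha^{(\delta)}$. An action of $G$ on $A$ is a group morphism $\beta$ from $G$ to the group of bicontinuous $*$-automorphisms of $A$; it is continuous if $(t,a)\mapsto\beta_t(a)$ is jointly continuous on $G\times A$. A continuous action $\beta$ is an inverse limit action if $A$ can be written as an inverse limit $\varprojlim_{\delta\in\Delta}A_\delta$ of $C^*$-algebras over a directed set in such a way that there are actions $\beta^{(\delta)}$ of $G$ on $A_\delta$ such that, for every $t\in G$, $\{\beta^{(\delta)}_t\}_\delta$ is an inverse system with $\beta_t=\varprojlim_\delta\beta_t^{(\delta)}$. Then the map $\Sigma$ given by $\Sigma(\alpha)_t(a)=\alpha(a)(t^{-1})$, $t\in G$, $a\in A$, is a well-defined bijection from the set of all inverse limit actions of $C^*\mathbf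 K_G^a$ on $A$ onto the set of all continuous inverse limit actions of $G$ on $A$. -/

import Mathlib

open Filter Topology
open scoped ZeroAtInfty BoundedContinuousFunction

universe u v w

/-! ### Locally C⋆-algebras -/

/-- A `C⋆`-seminorm on a complex `⋆`-algebra. -/
structure IsCStarSeminorm {A : Type u} [NonUnitalRing A] [StarRing A] [Module ℂ A]
    (p : Seminorm ℂ A) : Prop where
  mul_le : ∀ a b : A, p (a * b) ≤ p a * p b
  star_mul_self : ∀ a : A, p (star a * a) = p a ^ 2

/-- `S(A)`: the set of all continuous `C⋆`-seminorms on `A`. -/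
def cstarSeminorms (A : Type u) [NonUnitalRing A] [StarRing A] [Module ℂ A]
    [TopologicalSpace A] : Set (Seminorm ℂ A) :=
  {p | IsCStarSeminorm p ∧ Continuous p}

/-- A locally `C⋆`-algebra: a complete Hausdorff complex topological `⋆`-algebra whose topology is
determined by (its continuous) `C⋆`-seminorms.  The uniform structure is the one of the additive
topological group. The algebra need not have a unit. -/
class IsLocallyCStarAlgebra (A : Type u) [NonUnitalRing A] [StarRing A] [Module ℂ A]
    [UniformSpace A] : Prop extends IsScalarTower ℂ A A, SMulCommClass ℂ A A, StarModule ℂ A,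
    IsUniformAddGroup A, ContinuousSMul ℂ A, ContinuousMul A, ContinuousStar A,
    T2Space A, CompleteSpace A where
  withSeminorms : WithSeminorms (fun p : cstarSeminorms A => (p : Seminorm ℂ A))

/-- Every `C⋆`-algebra is a locally `C⋆`-algebra. -/
instance NonUnitalCStarAlgebra.isLocallyCStarAlgebra (B : Type u) [NonUnitalCStarAlgebra B] :
    IsLocallyCStarAlgebra B where
  withSeminorms := by
    have hn : normSeminorm ℂ B ∈ cstarSeminorms B :=
      ⟨⟨fun a b => norm_mul_le a b, fun a => by
        simpa [sq] using CStarRing.norm_star_mul_self (x := a)⟩, continuous_norm⟩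
    rw [SeminormFamily.withSeminorms_iff_nhds_eq_iInf]
    apply le_antisymm
    · refine le_iInf fun p => ?_
      rw [← tendsto_iff_comap]
      have h := p.2.2.tendsto 0
      rwa [map_zero] at h
    · refine (iInf_le _ ⟨normSeminorm ℂ B, hn⟩).trans ?_
      exact comap_norm_nhds_zero.le

/-- An approximate unit: an increasing net `(e i)` of positive elements (those of the form
`b⋆ b`), with `p (e i) ≤ 1` for every continuous `C⋆`-seminorm `p`, such that `e i * a → a` and
`a * e i → a` for every `a`. -/
structure IsApproxUnit {A : Type u} [NonUnitalRing A] [StarRing A] [Module ℂ A]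
    [TopologicalSpace A] {ι : Type w} [Preorder ι] (e : ι → A) : Prop where
  nonneg : ∀ i, ∃ b : A, e i = star b * b
  mono : ∀ i j, i ≤ j → ∃ b : A, e j - e i = star b * b
  le_one : ∀ p ∈ cstarSeminorms A, ∀ i, p (e i) ≤ 1
  tendsto_mul : ∀ a : A, Tendsto (fun i => e i * a) atTop (𝓝 a)
  mul_tendsto : ∀ a : A, Tendsto (fun i => a * e i) atTop (𝓝 a)

/-! ### Bounded continuous functions with values in a locally C⋆-algebra -/

section Cb

variable (X : Type v) [TopologicalSpace X]
variable (A : Type u) [NonUnitalRing A] [StarRing A] [Module ℂ A] [UniformSpace A]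
  [IsLocallyCStarAlgebra A]

/-- The bounded continuous functions `X → A`, as a `⋆`-subalgebra of all functions `X → A`;
bounded means bounded for each continuous `C⋆`-seminorm of `A`. -/
def cbSubalgebra : NonUnitalStarSubalgebra ℂ (X → A) where
  carrier := {F | Continuous F ∧ ∀ p ∈ cstarSeminorms A, ∃ C : ℝ, ∀ x, p (F x) ≤ C}
  add_mem' := by
    rintro F H ⟨hF, bF⟩ ⟨hH, bH⟩
    refine ⟨hF.add hH, fun p hp => ?_⟩
    obtain ⟨C, hC⟩ := bF p hp
    obtain ⟨D, hD⟩ := bH p hp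
    exact ⟨C + D, fun x => (map_add_le_add p _ _).trans (add_le_add (hC x) (hD x))⟩
  zero_mem' := ⟨continuous_const, fun p _ => ⟨0, fun x => by simp⟩⟩
  mul_mem' := by
    rintro F H ⟨hF, bF⟩ ⟨hH, bH⟩
    refine ⟨hF.mul hH, fun p hp => ?_⟩
    obtain ⟨C, hC⟩ := bF p hp
    obtain ⟨D, hD⟩ := bH p hp
    refine ⟨C * D, fun x => (hp.1.mul_le _ _).trans ?_⟩
    exact mul_le_mul (hC x) (hD x) (apply_nonneg p _) ((apply_nonneg p _).trans (hC x))
  smul_mem' := by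
    rintro c F ⟨hF, bF⟩
    refine ⟨hF.const_smul c, fun p hp => ?_⟩
    obtain ⟨C, hC⟩ := bF p hp
    refine ⟨‖c‖ * C, fun x => ?_⟩
    rw [Pi.smul_apply, map_smul_eq_mul]
    exact mul_le_mul_of_nonneg_left (hC x) (norm_nonneg c)
  star_mem' := by
    rintro F ⟨hF, bF⟩
    refine ⟨hF.star, fun p hp => ?_⟩
    obtain ⟨C, hC⟩ := bF p hp
    refine ⟨C, fun x => le_trans ?_ (hC x)⟩
    have h1 : p (star (F x)) ^ 2 ≤ p (F x) * p (star (F x)) := by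
      rw [← hp.1.star_mul_self, star_star]; exact hp.1.mul_le _ _
    rcases (apply_nonneg p (star (F x))).eq_or_lt with h0 | h0
    · rw [Pi.star_apply, ← h0]; exact apply_nonneg p _
    · rw [sq] at h1; exact le_of_mul_le_mul_right h1 h0

/-- `C_b(X, A)`, the `⋆`-algebra of bounded continuous functions from `X` to `A`.  For a locally
compact group `X = G` this is `M(A, C₀(G))`, a `⋆`-subalgebra of the multiplier algebra
of `A ⊗ C₀(G) = C₀(G, A)`, acting by pointwise multiplication. -/
def Cb : Type max u v := cbSubalgebra X A

noncomputable instance : NonUnitalRing (Cb X A) :=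
  inferInstanceAs (NonUnitalRing (cbSubalgebra X A))
noncomputable instance : StarRing (Cb X A) := inferInstanceAs (StarRing (cbSubalgebra X A))
noncomputable instance : Module ℂ (Cb X A) := inferInstanceAs (Module ℂ (cbSubalgebra X A))

variable {X A}

instance : FunLike (Cb X A) X A where
  coe F := F.1
  coe_injective := Subtype.coe_injective

/-- The topology of `C_b(X, A)` is that of uniform convergence, i.e. the one given by the
seminorms `‖F‖_p = sup_x p (F x)`, for `p` a continuous `C⋆`-seminorm of `A`. -/
instance : TopologicalSpace (Cb X A) :=
  TopologicalSpace.induced (fun F => UniformFun.ofFun (F : X → A)) inferInstance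

@[ext] theorem Cb.ext {F H : Cb X A} (h : ∀ x, F x = H x) : F = H := DFunLike.ext _ _ h

theorem Cb.continuous (F : Cb X A) : Continuous F := F.2.1

theorem Cb.bounded (F : Cb X A) (p : Seminorm ℂ A) (hp : p ∈ cstarSeminorms A) :
    ∃ C : ℝ, ∀ x, p (F x) ≤ C := F.2.2 p hp

theorem Cb.tendsto_iff {ι : Type w} {l : Filter ι} {F : ι → Cb X A} {F₀ : Cb X A} :
    Tendsto F l (𝓝 F₀) ↔
      ∀ p ∈ cstarSeminorms A, ∀ ε > 0, ∀ᶠ i in l, ∀ x, p (F i x - F₀ x) < ε := by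
  have hA := IsLocallyCStarAlgebra.withSeminorms (A := A)
  have hu := (SeminormFamily.withSeminorms_iff_uniformSpace_eq_iInf _).1 hA
  rw [nhds_induced, tendsto_comap_iff, UniformFun.tendsto_iff_tendstoUniformly]
  constructor
  · intro h p hp ε hε
    have hV : {q : A × A | p (q.2 - q.1) < ε} ∈ uniformity A := by
      rw [uniformity_eq_comap_nhds_zero]
      refine ⟨{a | p a < ε}, ?_, fun q hq => hq⟩
      exact (isOpen_lt hp.2 continuous_const).mem_nhds (by simpa using hε)
    exact h _ hV
  · intro h V hV
    rw [uniformity_eq_comap_nhds_zero] at hV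
    obtain ⟨W, hW, hWV⟩ := hV
    obtain ⟨s, r, hr, hs⟩ := (hA.mem_nhds_iff 0 W).1 hW
    have : ∀ᶠ i in l, ∀ p ∈ s, ∀ x, p.1 (F i x - F₀ x) < r :=
      (Filter.eventually_all_finset s).2 fun p _ => h p.1 p.2 r hr
    filter_upwards [this] with i hi x
    refine hWV (hs ?_)
    rw [Seminorm.mem_ball_zero]
    exact Seminorm.finset_sup_apply_lt hr fun p hp => hi p hp x

theorem Cb.continuous_eval : Continuous fun q : Cb X A × X => q.1 q.2 := by
  rw [continuous_iff_continuousAt]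
  rintro ⟨F, x⟩
  have h : Tendsto (fun q : Cb X A × X => q.1) (𝓝 (F, x)) (𝓝 F) := continuous_fst.tendsto _
  have hu : TendstoUniformly (fun (q : Cb X A × X) => (q.1 : X → A)) F (𝓝 (F, x)) := by
    rw [nhds_induced (fun F : Cb X A => UniformFun.ofFun (F : X → A)) F, tendsto_comap_iff,
      UniformFun.tendsto_iff_tendstoUniformly] at h
    exact h
  exact TendstoUniformly.tendsto_comp hu F.continuous.continuousAt
    (continuous_snd.tendsto (F, x))

/-- The elements of `A ⊗ C₀(X) = C₀(X, A)` among the bounded continuous functions. -/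
def Cb.VanishesAtInfty (F : Cb X A) : Prop := Tendsto F (cocompact X) (𝓝 0)

/-- The function `a ⊗ k : x ↦ k x • a`, for `k` a bounded continuous scalar function. -/
noncomputable def Cb.tmul (a : A) (k : X →ᵇ ℂ) : Cb X A :=
  ⟨fun x => k x • a, k.continuous.smul continuous_const, fun p _ => ⟨‖k‖ * p a, fun x => by
    rw [map_smul_eq_mul]
    exact mul_le_mul_of_nonneg_right (k.norm_coe_le_norm x) (apply_nonneg p a)⟩⟩

@[simp] theorem Cb.tmul_apply (a : A) (k : X →ᵇ ℂ) (x : X) : Cb.tmul a k x = k x • a := rfl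

/-- Composition with a continuous map. -/
def Cb.comp {Y : Type w} [TopologicalSpace Y] (F : Cb X A) (m : C(Y, X)) : Cb Y A :=
  ⟨fun y => F (m y), F.continuous.comp m.continuous, fun p hp =>
    (F.bounded p hp).imp fun _ hC y => hC (m y)⟩

@[simp] theorem Cb.comp_apply {Y : Type w} [TopologicalSpace Y] (F : Cb X A) (m : C(Y, X))
    (y : Y) : F.comp m y = F (m y) := rfl

/-- An `S`-morphism `A → M(A, C₀(X)) ⊆ M(A ⊗ C₀(X))`: a continuous `⋆`-morphism `α` such that for
each approximate unit `(e i)` of `A` the net `α (e i)` converges to `1` in the strict topology,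
i.e. `α (e i) h → h` and `h α (e i) → h` for all `h ∈ A ⊗ C₀(X)`. -/
structure IsSMorphism (α : A →⋆ₙₐ[ℂ] Cb X A) : Prop where
  continuous : Continuous α
  strict : ∀ (ι : Type u) [Preorder ι] [IsDirectedOrder ι] [Nonempty ι] (e : ι → A),
    IsApproxUnit e → ∀ h : Cb X A, h.VanishesAtInfty →
      Tendsto (fun i => α (e i) * h) atTop (𝓝 h) ∧ Tendsto (fun i => h * α (e i)) atTop (𝓝 h)

/-- The extension of `α ⊗ id : A ⊗ C₀(X) → M(A ⊗ C₀(X) ⊗ C₀(X))` to `M(A, C₀(X))`, with values in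
`M(A, C₀(X) ⊗ C₀(X)) = C_b(X × X, A)`: it maps `F` to `(s, t) ↦ α (F t) s`. -/
noncomputable def tensorId (α : A →⋆ₙₐ[ℂ] Cb X A) (hα : Continuous α) : Cb X A →⋆ₙₐ[ℂ] Cb (X × X) A where
  toFun F := ⟨fun q => α (F q.2) q.1,
    Cb.continuous_eval.comp
      ((hα.comp (F.continuous.comp continuous_snd)).prodMk continuous_fst), by
    intro p hp
    have hA := IsLocallyCStarAlgebra.withSeminorms (A := A)
    have h0 : Tendsto α (𝓝 0) (𝓝 0) := by simpa using hα.tendsto 0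
    have h1 := Cb.tendsto_iff.1 h0 p hp 1 one_pos
    obtain ⟨s, r, hr, hs⟩ := (hA.mem_nhds_iff 0 _).1 h1
    choose C hC using fun q : cstarSeminorms A => F.bounded q.1 q.2
    let D : ℝ := 1 + ∑ q ∈ s, |C q|
    have hD : 0 < D := add_pos_of_pos_of_nonneg one_pos (Finset.sum_nonneg fun _ _ => abs_nonneg _)
    have key : ∀ t, ∀ q ∈ s, q.1 (F t) < D := fun t q hq =>
      calc q.1 (F t) ≤ |C q| := (hC q t).trans (le_abs_self _)
        _ ≤ ∑ q ∈ s, |C q| := Finset.single_le_sum (f := fun q => |C q|) (fun _ _ => abs_nonneg _) hq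
        _ < D := lt_one_add _
    refine ⟨D / r, fun x => ?_⟩
    let c : ℂ := ((r / D : ℝ) : ℂ)
    have hc : ‖c‖ = r / D := by
      rw [Complex.norm_real, Real.norm_of_nonneg (div_pos hr hD).le]
    have hm : c • F x.2 ∈ (s.sup fun q : cstarSeminorms A => (q : Seminorm ℂ A)).ball 0 r := by
      rw [Seminorm.mem_ball_zero]
      refine Seminorm.finset_sup_apply_lt hr fun q hq => ?_
      rw [map_smul_eq_mul, hc]
      calc r / D * q.1 (F x.2) < r / D * D :=
            mul_lt_mul_of_pos_left (key _ q hq) (div_pos hr hD)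
        _ = r := div_mul_cancel₀ _ hD.ne'
    have h2 : p (α (c • F x.2) x.1 - (0 : Cb X A) x.1) < 1 := hs hm x.1
    have h3 : α (c • F x.2) x.1 - (0 : Cb X A) x.1 = c • α (F x.2) x.1 := by
      rw [map_smul]; exact sub_zero _
    rw [h3, map_smul_eq_mul, hc] at h2
    have h4 : p (α (F x.2) x.1) < D / r := by
      rw [lt_div_iff₀ hr]
      rw [div_mul_eq_mul_div, div_lt_one hD] at h2
      linarith
    exact h4.le⟩
  map_smul' c F := Cb.ext fun q => by
    change α (c • F q.2) q.1 = c • α (F q.2) q.1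
    rw [map_smul]; rfl
  map_zero' := Cb.ext fun q => by
    change α 0 q.1 = 0
    rw [map_zero]; rfl
  map_add' F H := Cb.ext fun q => by
    change α (F q.2 + H q.2) q.1 = α (F q.2) q.1 + α (H q.2) q.1
    rw [map_add]; rfl
  map_mul' F H := Cb.ext fun q => by
    change α (F q.2 * H q.2) q.1 = α (F q.2) q.1 * α (H q.2) q.1
    rw [map_mul]; rfl
  map_star' F := Cb.ext fun q => by
    change α (star (F q.2)) q.1 = star (α (F q.2) q.1)
    rw [map_star]; rfl

theorem tensorId_apply (α : A →⋆ₙₐ[ℂ] Cb X A) (hα : Continuous α) (F : Cb X A) (s t : X) :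
    tensorId α hα F (s, t) = α (F t) s := rfl

theorem tensorId_tmul (α : A →⋆ₙₐ[ℂ] Cb X A) (hα : Continuous α) (a : A) (k : X →ᵇ ℂ)
    (s t : X) : tensorId α hα (Cb.tmul a k) (s, t) = k t • α a s := by
  rw [tensorId_apply, Cb.tmul_apply, map_smul]; rfl

end Cb

/-! ### Actions of the commutative Kac C⋆-algebra of a group -/

section Kac

variable (G : Type v) [Group G] [TopologicalSpace G] [IsTopologicalGroup G]
variable {A : Type u} [NonUnitalRing A] [StarRing A] [Module ℂ A] [UniformSpace A]
  [IsLocallyCStarAlgebra A]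

variable {G} in
/-- The comultiplication `d` of the commutative Kac `C⋆`-algebra `(C₀(G), d, j, ds)`, with values in
`M(C₀(G) ⊗ C₀(G)) = C_b(G × G)`: `d f (s, t) = f (s t)`. -/
noncomputable def kacComul (f : C₀(G, ℂ)) : G × G →ᵇ ℂ :=
  f.toBCF.compContinuous ⟨fun q => q.1 * q.2, by fun_prop⟩

variable {G} in
/-- The flip `σ` on `M(C₀(G) ⊗ C₀(G)) = C_b(G × G)`. -/
noncomputable def kacFlip (k : G × G →ᵇ ℂ) : G × G →ᵇ ℂ :=
  k.compContinuous ⟨Prod.swap, continuous_swap⟩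

variable (A) in
/-- The extension of `id ⊗ (σ ∘ d) : A ⊗ C₀(G) → M(A ⊗ C₀(G) ⊗ C₀(G))` to `M(A, C₀(G))`, with values
in `M(A, C₀(G) ⊗ C₀(G)) = C_b(G × G, A)`: it maps `F` to `(s, t) ↦ F (t s)`. -/
def idTensorFlipComul : Cb G A →⋆ₙₐ[ℂ] Cb (G × G) A where
  toFun F := F.comp ⟨fun q => q.2 * q.1, by fun_prop⟩
  map_smul' _ _ := rfl
  map_zero' := rfl
  map_add' _ _ := rfl
  map_mul' _ _ := rfl
  map_star' _ := rfl

theorem idTensorFlipComul_tmul (a : A) (f : C₀(G, ℂ)) :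
    idTensorFlipComul G A (Cb.tmul a f.toBCF) = Cb.tmul a (kacFlip (kacComul f)) := rfl

variable (A) in
/-- An action of the commutative Kac `C⋆`-algebra of `G` on `A`: an injective `S`-morphism
`α : A → M(A, C₀(G))` with `(α ⊗ id) ∘ α = (id ⊗ (σ ∘ d)) ∘ α`. -/
structure KacAction where
  toHom : A →⋆ₙₐ[ℂ] Cb G A
  isSMorphism : IsSMorphism toHom
  injective : Function.Injective toHom
  coaction : ∀ a, tensorId toHom isSMorphism.continuous (toHom a) =
    idTensorFlipComul G A (toHom a)

variable (A) in
/-- An action of `G` on `A`: a morphism from `G` to the group of automorphisms of the locally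
`C⋆`-algebra `A`, i.e. bicontinuous `⋆`-automorphisms (the inverse of `toHom t` is `toHom t⁻¹`). -/
structure GroupAction where
  toHom : G →* (A ≃⋆ₐ[ℂ] A)
  continuous_apply : ∀ t, Continuous (toHom t)

variable {G} in
/-- The action of `G` on `A` is continuous: `(t, a) ↦ α_t a` is jointly continuous. -/
def GroupAction.IsContinuous (β : GroupAction G A) : Prop :=
  Continuous fun q : G × A => β.toHom q.1 q.2

end Kac

/-! ### Inverse limits -/

/-- A way of writing `A` as the inverse limit of an inverse system of `C⋆`-algebras over a directed
set `Δ`: the canonical maps `proj δ` identify `A` with the compatible families in the product, with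
the topology of the product. Connecting maps need not be surjective. -/
structure CStarInverseLimit (A : Type u) [NonUnitalRing A] [StarRing A] [Module ℂ A]
    [UniformSpace A] where
  Δ : Type u
  [preorder : Preorder Δ]
  [directed : IsDirectedOrder Δ]
  [nonempty : Nonempty Δ]
  obj : Δ → Type u
  [cstar : ∀ δ, NonUnitalCStarAlgebra (obj δ)]
  map : ∀ {δ ε : Δ}, δ ≤ ε → (obj ε →⋆ₙₐ[ℂ] obj δ)
  map_refl : ∀ (δ : Δ) (x : obj δ), map (le_refl δ) x = x
  map_map : ∀ {δ ε ζ : Δ} (h : δ ≤ ε) (k : ε ≤ ζ) (x : obj ζ),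
    map h (map k x) = map (h.trans k) x
  proj : ∀ δ, A →⋆ₙₐ[ℂ] obj δ
  map_proj : ∀ {δ ε : Δ} (h : δ ≤ ε) (a : A), map h (proj ε a) = proj δ a
  existsUnique_lift : ∀ x : ∀ δ, obj δ, (∀ {δ ε : Δ} (h : δ ≤ ε), map h (x ε) = x δ) →
    ∃! a : A, ∀ δ, proj δ a = x δ
  isInducing : IsInducing fun (a : A) (δ : Δ) => proj δ a

attribute [instance] CStarInverseLimit.preorder CStarInverseLimit.directed
  CStarInverseLimit.nonempty CStarInverseLimit.cstar

section InverseLimitActions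

variable {G : Type v} [Group G] [TopologicalSpace G] [IsTopologicalGroup G]
variable {A : Type u} [NonUnitalRing A] [StarRing A] [Module ℂ A] [UniformSpace A]
  [IsLocallyCStarAlgebra A]

/-- `α` is an inverse limit action of the Kac `C⋆`-algebra: `A` can be written as an inverse limit of
`C⋆`-algebras `A_δ` carrying actions `α^(δ)` that form an inverse system with limit `α`.
(The connecting and canonical maps act on `C_b(G, ·)` by composition.) -/
def KacAction.IsInverseLimit (α : KacAction G A) : Prop :=
  ∃ (L : CStarInverseLimit A) (αd : ∀ δ, KacAction G (L.obj δ)),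
    (∀ {δ ε : L.Δ} (h : δ ≤ ε) (x : L.obj ε) (t : G),
      L.map h ((αd ε).toHom x t) = (αd δ).toHom (L.map h x) t) ∧
    ∀ (δ : L.Δ) (a : A) (t : G), L.proj δ (α.toHom a t) = (αd δ).toHom (L.proj δ a) t

/-- `β` is an inverse limit action of `G`: `A` can be written as an inverse limit of `C⋆`-algebras
`A_δ` carrying actions `β^(δ)` of `G` such that, for each `t`, the `β^(δ)_t` form an inverse system
with limit `β_t`. -/
def GroupAction.IsInverseLimit (β : GroupAction G A) : Prop :=
  ∃ (L : CStarInverseLimit A) (βd : ∀ δ, GroupAction G (L.obj δ)),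
    (∀ {δ ε : L.Δ} (h : δ ≤ ε) (t : G) (x : L.obj ε),
      L.map h ((βd ε).toHom t x) = (βd δ).toHom t (L.map h x)) ∧
    ∀ (δ : L.Δ) (t : G) (a : A), L.proj δ (β.toHom t a) = (βd δ).toHom t (L.proj δ a)

end InverseLimitActions

/-!
A Kac action `α` and a group action `β` correspond under `β t a = α a t⁻¹`, so the coaction identity
`α (α a t) s = α a (t s)` is the multiplicativity of `β`, injectivity of `α` gives `β 1 = id`, and
joint continuity of `β` is joint continuity of evaluation on `C_b(G, A)`.  This needs no inverse
limit and turns Kac actions into continuous group actions; applied to `A` and to each `A_δ` it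
preserves inverse limits.

Conversely, let `β` be the limit of actions `β^(δ)` on `A_δ`.  Automorphisms of `C⋆`-algebras are
isometric, so `a ↦ ‖proj δ a‖` is a `β`-invariant continuous `C⋆`-seminorm, and these seminorms
determine the topology (`CStarInverseLimit.exists_le_norm_proj`).  Invariance makes
`t ↦ β t⁻¹ a` bounded and makes its dependence on `a` continuous.  It also gives
strictness: `q (β t⁻¹ (e i) * h t - h t) = q (e i * k t - k t)` with `k t = β t (h t)`, which vanishes
at infinity for `q`, and left multiplications by the `e i` are `q`-contractive, hence converge
uniformly on compact sets (`eventually_forall_seminorm_map_sub_lt`).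

The actions `β^(δ)` need not be continuous in the group variable off the image of `A`.  Therefore
`A_δ` is replaced by the closure of `proj δ A` (`CStarInverseLimit.closureRange`), which `β^(δ)`
leaves invariant and on which it is jointly continuous, because it is isometric and its orbit maps are
continuous on a dense set.  The same construction then yields the Kac action on each closure.
-/

/-! ### Uniform convergence for nets of contractions -/

/-- A net of `q`-contractive additive maps converging pointwise to the identity converges uniformly on
the values of a continuous function that vanishes at infinity for `q`. -/
theorem eventually_forall_seminorm_map_sub_lt {A : Type*} [AddCommGroup A] [Module ℂ A]
    [TopologicalSpace A] [IsTopologicalAddGroup A] {q : Seminorm ℂ A} (hq : Continuous q)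
    {ι : Type*} {l : Filter ι} {f : ι → A →+ A} (hf : ∀ i a, q (f i a) ≤ q a)
    (hlim : ∀ a, Tendsto (fun i => f i a) l (𝓝 a))
    {X : Type*} [TopologicalSpace X] {k : X → A} (hk : Continuous k)
    (hk0 : Tendsto (fun x => q (k x)) (cocompact X) (𝓝 0)) {ε : ℝ} (hε : 0 < ε) :
    ∀ᶠ i in l, ∀ x, q (f i (k x) - k x) < ε := by
  obtain ⟨K, hK, hKs⟩ := mem_cocompact.1 (hk0.eventually (gt_mem_nhds (half_pos hε)))
  have hloc : ∀ x ∈ K, ∀ᶠ z : X × ι in 𝓝 x ×ˢ l, q (f z.2 (k z.1) - k z.1) < ε := by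
    intro x _
    have h1 : ∀ᶠ y in 𝓝 x, q (k y - k x) < ε / 3 := by
      have : Tendsto (fun y => q (k y - k x)) (𝓝 x) (𝓝 (q (k x - k x))) :=
        (hq.comp (hk.sub continuous_const)).tendsto x
      rw [sub_self, map_zero] at this
      exact this.eventually (gt_mem_nhds (by positivity))
    have h2 : ∀ᶠ i in l, q (f i (k x) - k x) < ε / 3 := by
      have := (hq.tendsto _).comp ((hlim (k x)).sub_const (k x))
      rw [sub_self, map_zero] at this
      exact this.eventually (gt_mem_nhds (by positivity))
    filter_upwards [h1.prod_mk h2] with ⟨y, i⟩ ⟨hy, hi⟩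
    dsimp only at hy hi ⊢
    have e : f i (k y) - k y = f i (k y - k x) + (f i (k x) - k x) - (k y - k x) := by
      rw [map_sub]; abel
    calc q (f i (k y) - k y)
        ≤ q (f i (k y - k x)) + q (f i (k x) - k x) + q (k y - k x) := by
          rw [e]
          exact (map_sub_le_add q _ _).trans (by gcongr; exact map_add_le_add q _ _)
      _ < ε := by linarith [hf i (k y - k x)]
  have hKev : ∀ᶠ i in l, ∀ x ∈ K, q (f i (k x) - k x) < ε := by
    refine hK.induction_on (p := fun s => ∀ᶠ i in l, ∀ x ∈ s, q (f i (k x) - k x) < ε)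
      (by simp) (fun s t hst ht => ht.mono fun i hi x hx => hi x (hst hx))
      (fun s t hs ht => ?_) fun x hx => ?_
    · filter_upwards [hs, ht] with i h1 h2 x hx
      exact hx.elim (h1 x) (h2 x)
    · obtain ⟨pa, ha, pb, hb, hab⟩ := eventually_prod_iff.1 (hloc x hx)
      exact ⟨{y | pa y}, mem_nhdsWithin_of_mem_nhds ha, hb.mono fun i hi y hy => hab hy hi⟩
  filter_upwards [hKev] with i hi x
  by_cases hx : x ∈ K
  · exact hi x hx
  · have hx' : q (k x) < ε / 2 := hKs hx
    calc q (f i (k x) - k x) ≤ q (f i (k x)) + q (k x) := map_sub_le_add q _ _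
      _ < ε := by linarith [hf i (k x)]

/-! ### Constructing group actions -/

section Actions

variable {G : Type v} [Group G] [TopologicalSpace G] [IsTopologicalGroup G]
variable {A : Type u} [NonUnitalRing A] [StarRing A] [Module ℂ A] [UniformSpace A]
  [IsLocallyCStarAlgebra A]

omit [TopologicalSpace G] [IsTopologicalGroup G] [IsLocallyCStarAlgebra A] in
theorem GroupAction.ext_apply {β γ : GroupAction G A}
    (h : ∀ t a, β.toHom t a = γ.toHom t a) : β = γ := by
  cases β; cases γ
  congr
  exact MonoidHom.ext fun t => StarAlgEquiv.ext (h t)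

theorem KacAction.ext_apply {α γ : KacAction G A}
    (h : ∀ a t, α.toHom a t = γ.toHom a t) : α = γ := by
  have : α.toHom = γ.toHom := NonUnitalStarAlgHom.ext fun a => Cb.ext (h a)
  cases α; cases γ
  congr

omit [TopologicalSpace G] [IsTopologicalGroup G] [IsLocallyCStarAlgebra A] in
@[simp] theorem GroupAction.one_apply (β : GroupAction G A) (a : A) : β.toHom 1 a = a := by
  rw [map_one]; rfl

omit [TopologicalSpace G] [IsTopologicalGroup G] [IsLocallyCStarAlgebra A] in
theorem GroupAction.mul_apply (β : GroupAction G A) (s t : G) (a : A) :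
    β.toHom (s * t) a = β.toHom s (β.toHom t a) := by
  rw [map_mul]; rfl

/-- The group action given by continuous `⋆`-endomorphisms `φ t` with `φ 1 = id` and
`φ (s t) = φ s ∘ φ t`; they are automorphisms because `φ t⁻¹` inverts `φ t`. -/
def GroupAction.ofEnd (φ : G → A →⋆ₙₐ[ℂ] A) (hone : ∀ a, φ 1 a = a)
    (hmul : ∀ s t a, φ (s * t) a = φ s (φ t a)) (hc : ∀ t, Continuous (φ t)) :
    GroupAction G A where
  toHom :=
    { toFun := fun t =>
        { toFun := φ t
          invFun := φ t⁻¹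
          left_inv := fun a => by rw [← hmul, inv_mul_cancel, hone]
          right_inv := fun a => by rw [← hmul, mul_inv_cancel, hone]
          map_mul' := map_mul (φ t)
          map_add' := map_add (φ t)
          map_star' := map_star (φ t)
          map_smul' := map_smul (φ t) }
      map_one' := StarAlgEquiv.ext hone
      map_mul' := fun s t => StarAlgEquiv.ext (hmul s t) }
  continuous_apply := hc

omit [TopologicalSpace G] [IsTopologicalGroup G] [IsLocallyCStarAlgebra A] in
@[simp] theorem GroupAction.ofEnd_apply (φ : G → A →⋆ₙₐ[ℂ] A) (hone : ∀ a, φ 1 a = a)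
    (hmul : ∀ s t a, φ (s * t) a = φ s (φ t a)) (hc : ∀ t, Continuous (φ t)) (t : G) (a : A) :
    (GroupAction.ofEnd φ hone hmul hc).toHom t a = φ t a := rfl

/-! ### From Kac actions to group actions -/

theorem KacAction.apply_apply (α : KacAction G A) (a : A) (s t : G) :
    α.toHom (α.toHom a t) s = α.toHom a (t * s) :=
  DFunLike.congr_fun (α.coaction a) (s, t)

theorem KacAction.apply_one (α : KacAction G A) (a : A) : α.toHom a 1 = a :=
  α.injective (Cb.ext fun s => by rw [α.apply_apply, one_mul])

/-- The group action `t ↦ (a ↦ α a t⁻¹)` of a Kac action `α`. -/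
noncomputable def KacAction.toGroupAction (α : KacAction G A) : GroupAction G A :=
  GroupAction.ofEnd
    (fun t =>
      { toFun := fun a => α.toHom a t⁻¹
        map_smul' := fun c a => by rw [map_smul]; rfl
        map_zero' := by rw [map_zero]; rfl
        map_add' := fun a b => by rw [map_add]; rfl
        map_mul' := fun a b => by rw [map_mul]; rfl
        map_star' := fun a => by rw [map_star]; rfl })
    (fun a => by
      change α.toHom a 1⁻¹ = a
      rw [inv_one, α.apply_one])
    (fun s t a => by
      change α.toHom a (s * t)⁻¹ = α.toHom (α.toHom a t⁻¹) s⁻¹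
      rw [α.apply_apply, mul_inv_rev])
    (fun t => Cb.continuous_eval.comp (α.isSMorphism.continuous.prodMk continuous_const))

@[simp] theorem KacAction.toGroupAction_apply (α : KacAction G A) (t : G) (a : A) :
    α.toGroupAction.toHom t a = α.toHom a t⁻¹ := rfl

theorem KacAction.toGroupAction_isContinuous (α : KacAction G A) :
    α.toGroupAction.IsContinuous :=
  Cb.continuous_eval.comp
    ((α.isSMorphism.continuous.comp continuous_snd).prodMk continuous_fst.inv)

theorem KacAction.IsInverseLimit.toGroupAction {α : KacAction G A} (h : α.IsInverseLimit) :
    α.toGroupAction.IsInverseLimit := by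
  obtain ⟨L, αd, hmap, hproj⟩ := h
  exact ⟨L, fun δ => (αd δ).toGroupAction, fun h t x => hmap h x t⁻¹,
    fun δ t a => hproj δ a t⁻¹⟩

/-! ### From group actions with invariant seminorms to Kac actions -/

/-- The topology of `A` is determined by the `β`-invariant continuous `C⋆`-seminorms. -/
def GroupAction.HasInvariantSeminorms (β : GroupAction G A) : Prop :=
  ∀ p ∈ cstarSeminorms A, ∃ q ∈ cstarSeminorms A,
    (∃ C > 0, ∀ a, p a ≤ C * q a) ∧ ∀ t a, q (β.toHom t a) = q a

/-- The `⋆`-morphism `A → C_b(G, A)`, `a ↦ (t ↦ β t⁻¹ a)`. -/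
noncomputable def GroupAction.toCb (β : GroupAction G A) (hc : β.IsContinuous)
    (hβ : β.HasInvariantSeminorms) : A →⋆ₙₐ[ℂ] Cb G A where
  toFun a := ⟨fun t => β.toHom t⁻¹ a, hc.comp (continuous_inv.prodMk continuous_const), by
    intro p hp
    obtain ⟨q, -, ⟨C, -, hC⟩, hinv⟩ := hβ p hp
    exact ⟨C * q a, fun t => (hC _).trans_eq (by rw [hinv])⟩⟩
  map_smul' c a := Cb.ext fun t => map_smul (β.toHom t⁻¹) c a
  map_zero' := Cb.ext fun t => map_zero (β.toHom t⁻¹)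
  map_add' a b := Cb.ext fun t => map_add (β.toHom t⁻¹) a b
  map_mul' a b := Cb.ext fun t => map_mul (β.toHom t⁻¹) a b
  map_star' a := Cb.ext fun t => map_star (β.toHom t⁻¹) a

@[simp] theorem GroupAction.toCb_apply (β : GroupAction G A) (hc : β.IsContinuous)
    (hβ : β.HasInvariantSeminorms) (a : A) (t : G) : β.toCb hc hβ a t = β.toHom t⁻¹ a := rfl

theorem GroupAction.continuous_toCb (β : GroupAction G A) (hc : β.IsContinuous)
    (hβ : β.HasInvariantSeminorms) : Continuous (β.toCb hc hβ) := by
  refine continuous_iff_continuousAt.2 fun a => Cb.tendsto_iff.2 fun p hp ε hε => ?_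
  obtain ⟨q, hq, ⟨C, hC0, hC⟩, hinv⟩ := hβ p hp
  have h : Tendsto (fun b => q (b - a)) (𝓝 a) (𝓝 (q (a - a))) :=
    (hq.2.comp (continuous_id.sub continuous_const)).tendsto a
  rw [sub_self, map_zero] at h
  filter_upwards [h.eventually (gt_mem_nhds (div_pos hε hC0))] with b hb t
  rw [toCb_apply, toCb_apply, ← map_sub]
  calc p (β.toHom t⁻¹ (b - a)) ≤ C * q (b - a) := by rw [← hinv t⁻¹ (b - a)]; exact hC _
    _ < ε := by rwa [lt_div_iff₀' hC0] at hb

theorem GroupAction.isSMorphism_toCb (β : GroupAction G A) (hc : β.IsContinuous)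
    (hβ : β.HasInvariantSeminorms) : IsSMorphism (β.toCb hc hβ) where
  continuous := β.continuous_toCb hc hβ
  strict ι _ _ _ e he h hh := by
    have hk : Continuous fun t => β.toHom t (h t) := hc.comp (continuous_id.prodMk h.continuous)
    -- Translating by `β t` moves the action from `e i` to `h t`, for an invariant seminorm.
    have htrans : ∀ t a, β.toHom t (β.toHom t⁻¹ a) = a := fun t a => by
      rw [← β.mul_apply, mul_inv_cancel, β.one_apply]
    have main : ∀ f : ι → A →+ A,
        (∀ q ∈ cstarSeminorms A, ∀ i a, q (f i a) ≤ q a) →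
        (∀ a, Tendsto (fun i => f i a) atTop (𝓝 a)) →
        ∀ F : ι → Cb G A, (∀ i t, β.toHom t (F i t) = f i (β.toHom t (h t))) →
        Tendsto F atTop (𝓝 h) := by
      intro f hf hlim F hF
      refine Cb.tendsto_iff.2 fun p hp ε hε => ?_
      obtain ⟨q, hq, ⟨C, hC0, hC⟩, hinv⟩ := hβ p hp
      have hk0 : Tendsto (fun t => q (β.toHom t (h t))) (cocompact G) (𝓝 0) := by
        have h0 := (hq.2.tendsto 0).comp hh
        rw [map_zero] at h0
        exact h0.congr fun t => (hinv t (h t)).symm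
      filter_upwards [eventually_forall_seminorm_map_sub_lt hq.2 (hf q hq) hlim hk hk0
        (div_pos hε hC0)] with i hi t
      have ht := hi t
      rw [← hF, ← map_sub, hinv, lt_div_iff₀' hC0] at ht
      exact (hC _).trans_lt ht
    constructor
    · refine main (fun i => AddMonoidHom.mulLeft (e i)) (fun q hq i a => ?_) he.tendsto_mul _
        fun i t => ?_
      · exact (hq.1.mul_le _ _).trans
          (mul_le_of_le_one_left (apply_nonneg q a) (he.le_one q hq i))
      · change β.toHom t (β.toHom t⁻¹ (e i) * h t) = e i * β.toHom t (h t)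
        rw [map_mul, htrans]
    · refine main (fun i => AddMonoidHom.mulRight (e i)) (fun q hq i a => ?_) he.mul_tendsto _
        fun i t => ?_
      · exact (hq.1.mul_le _ _).trans
          (mul_le_of_le_one_right (apply_nonneg q a) (he.le_one q hq i))
      · change β.toHom t (h t * β.toHom t⁻¹ (e i)) = β.toHom t (h t) * e i
        rw [map_mul, htrans]

/-- The Kac action `a ↦ (t ↦ β t⁻¹ a)` of a continuous group action `β` with invariant
seminorms. -/
noncomputable def GroupAction.toKacAction (β : GroupAction G A) (hc : β.IsContinuous)
    (hβ : β.HasInvariantSeminorms) : KacAction G A where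
  toHom := β.toCb hc hβ
  isSMorphism := β.isSMorphism_toCb hc hβ
  injective a b hab := by
    simpa using DFunLike.congr_fun hab (1 : G)
  coaction a := Cb.ext fun ⟨s, t⟩ => by
    change β.toHom s⁻¹ (β.toHom t⁻¹ a) = β.toHom (t * s)⁻¹ a
    rw [mul_inv_rev, β.mul_apply]

@[simp] theorem GroupAction.toKacAction_apply (β : GroupAction G A) (hc : β.IsContinuous)
    (hβ : β.HasInvariantSeminorms) (a : A) (t : G) :
    (β.toKacAction hc hβ).toHom a t = β.toHom t⁻¹ a := rfl

end Actions

/-! ### Group actions on C⋆-algebras -/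

section CStarAlgebra

variable {G : Type v} [Group G] [TopologicalSpace G] [IsTopologicalGroup G]
variable {B : Type u} [NonUnitalCStarAlgebra B]

theorem normSeminorm_mem_cstarSeminorms : normSeminorm ℂ B ∈ cstarSeminorms B :=
  ⟨⟨norm_mul_le, fun a => by simpa [sq] using CStarRing.norm_star_mul_self (x := a)⟩,
    continuous_norm⟩

omit [TopologicalSpace G] [IsTopologicalGroup G] in
theorem GroupAction.norm_apply (β : GroupAction G B) (t : G) (x : B) : ‖β.toHom t x‖ = ‖x‖ :=
  NonUnitalStarAlgHom.norm_map (β.toHom t) (β.toHom t).injective x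

omit [TopologicalSpace G] [IsTopologicalGroup G] in
theorem GroupAction.hasInvariantSeminorms_of_cstar (β : GroupAction G B) :
    β.HasInvariantSeminorms := by
  intro p hp
  obtain ⟨C, hC0, hC⟩ := Seminorm.bound_of_continuous_normedSpace p hp.2
  exact ⟨normSeminorm ℂ B, normSeminorm_mem_cstarSeminorms, ⟨C, hC0, hC⟩, β.norm_apply⟩

omit [IsTopologicalGroup G] in
/-- An action on a `C⋆`-algebra is jointly continuous once the orbit maps of a dense set of elements
are continuous, since it is isometric. -/
theorem GroupAction.isContinuous_of_dense (β : GroupAction G B) {D : Set B} (hD : Dense D)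
    (h : ∀ x ∈ D, Continuous fun t => β.toHom t x) : β.IsContinuous := by
  refine continuous_iff_continuousAt.2 fun ⟨t, x⟩ => Metric.tendsto_nhds.2 fun ε hε => ?_
  obtain ⟨y, hy, hxy⟩ := Metric.mem_closure_iff.1 (hD x) (ε / 4) (by positivity)
  have h1 : ∀ᶠ s in 𝓝 t, dist (β.toHom s y) (β.toHom t y) < ε / 4 :=
    Metric.tendsto_nhds.1 ((h y hy).tendsto t) _ (by positivity)
  have h2 : ∀ᶠ z in 𝓝 x, dist z x < ε / 4 := Metric.ball_mem_nhds x (by positivity)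
  have hiso : ∀ s a b, dist (β.toHom s a) (β.toHom s b) = dist a b := fun s a b => by
    rw [dist_eq_norm, ← map_sub, β.norm_apply, dist_eq_norm]
  rw [nhds_prod_eq]
  filter_upwards [h1.prod_mk h2] with ⟨s, z⟩ ⟨hs, hz⟩
  dsimp only at hs hz ⊢
  calc dist (β.toHom s z) (β.toHom t x)
      ≤ dist (β.toHom s z) (β.toHom s x) + dist (β.toHom s x) (β.toHom s y)
          + dist (β.toHom s y) (β.toHom t y) + dist (β.toHom t y) (β.toHom t x) :=
        (dist_triangle _ _ _).trans (add_le_add_left (dist_triangle4 _ _ _ _) _)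
    _ < ε := by
      rw [hiso, hiso, hiso, dist_comm y x]
      linarith

end CStarAlgebra

/-! ### Inverse limits -/

namespace CStarInverseLimit

variable {A : Type u} [NonUnitalRing A] [StarRing A] [Module ℂ A] [UniformSpace A]

theorem continuous_proj (L : CStarInverseLimit A) (δ : L.Δ) : Continuous (L.proj δ) :=
  (continuous_apply δ).comp L.isInducing.continuous

/-- The continuous `C⋆`-seminorm `a ↦ ‖proj δ a‖`. -/
noncomputable def projSeminorm (L : CStarInverseLimit A) (δ : L.Δ) : Seminorm ℂ A :=
  (normSeminorm ℂ (L.obj δ)).comp (L.proj δ : A →ₗ[ℂ] L.obj δ)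

@[simp] theorem projSeminorm_apply (L : CStarInverseLimit A) (δ : L.Δ) (a : A) :
    L.projSeminorm δ a = ‖L.proj δ a‖ := rfl

theorem projSeminorm_mem (L : CStarInverseLimit A) (δ : L.Δ) :
    L.projSeminorm δ ∈ cstarSeminorms A := by
  refine ⟨⟨fun a b => ?_, fun a => ?_⟩, (L.continuous_proj δ).norm⟩
  · simpa using norm_mul_le (L.proj δ a) (L.proj δ b)
  · simpa [sq, map_star] using CStarRing.norm_star_mul_self (x := L.proj δ a)

theorem withSeminorms [IsTopologicalAddGroup A] (L : CStarInverseLimit A) :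
    WithSeminorms L.projSeminorm := by
  rw [SeminormFamily.withSeminorms_iff_nhds_eq_iInf, L.isInducing.nhds_eq_comap, nhds_pi,
    Filter.pi, comap_iInf]
  refine iInf_congr fun δ => ?_
  rw [comap_comap, map_zero, ← comap_norm_nhds_zero, comap_comap]
  rfl

/-- Directedness reduces the finitely many seminorms bounding `p` to a single one. -/
theorem exists_le_norm_proj [IsTopologicalAddGroup A] (L : CStarInverseLimit A)
    {p : Seminorm ℂ A} (hp : Continuous p) : ∃ δ, ∃ C > 0, ∀ a, p a ≤ C * ‖L.proj δ a‖ := by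
  obtain ⟨s, C, hC0, hC⟩ := Seminorm.bound_of_continuous L.withSeminorms p hp
  obtain ⟨δ, hδ⟩ := s.exists_le
  have hs : s.sup L.projSeminorm ≤ L.projSeminorm δ := Finset.sup_le fun ε hε a => by
    rw [projSeminorm_apply, projSeminorm_apply, ← L.map_proj (hδ ε hε)]
    exact NonUnitalStarAlgHom.norm_apply_le _ _
  refine ⟨δ, C, by positivity, fun a => (hC a).trans ?_⟩
  exact mul_le_mul_of_nonneg_left (hs a) C.2

/-- The closure of the range of `proj δ`, a `C⋆`-subalgebra of `obj δ`. -/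
def closureRange (L : CStarInverseLimit A) (δ : L.Δ) : NonUnitalStarSubalgebra ℂ (L.obj δ) :=
  (NonUnitalStarAlgHom.range (L.proj δ)).topologicalClosure

noncomputable instance (L : CStarInverseLimit A) (δ : L.Δ) :
    NonUnitalCStarAlgebra (L.closureRange δ) :=
  NonUnitalStarSubalgebra.nonUnitalCStarAlgebra _
    (h_closed := NonUnitalStarSubalgebra.isClosed_topologicalClosure _)

theorem proj_mem_closureRange (L : CStarInverseLimit A) (δ : L.Δ) (a : A) :
    L.proj δ a ∈ L.closureRange δ :=
  subset_closure ⟨a, rfl⟩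

/-- A continuous map between the `C⋆`-algebras of the system maps the closures of the images of `A`
into each other if it does so for the images. -/
theorem apply_mem_closureRange (L : CStarInverseLimit A) {δ ε : L.Δ} {f : L.obj ε → L.obj δ}
    (hf : Continuous f) (h : ∀ a, f (L.proj ε a) ∈ L.closureRange δ) {x : L.obj ε}
    (hx : x ∈ L.closureRange ε) : f x ∈ L.closureRange δ := by
  have hcl : IsClosed (f ⁻¹' (L.closureRange δ : Set (L.obj δ))) :=
    IsClosed.preimage hf (NonUnitalStarSubalgebra.isClosed_topologicalClosure _)
  refine closure_minimal ?_ hcl hx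
  rintro _ ⟨a, rfl⟩
  exact h a

theorem map_mem_closureRange (L : CStarInverseLimit A) {δ ε : L.Δ} (h : δ ≤ ε) {x : L.obj ε}
    (hx : x ∈ L.closureRange ε) : L.map h x ∈ L.closureRange δ :=
  L.apply_mem_closureRange (AddMonoidHomClass.continuous_of_bound (L.map h) 1 fun x => by
      rw [one_mul]; exact NonUnitalStarAlgHom.norm_apply_le _ _)
    (fun a => by rw [L.map_proj]; exact L.proj_mem_closureRange δ a) hx

/-- The inverse system of the closures of the images of `A`, which has the same limit `A`. -/
noncomputable def closure (L : CStarInverseLimit A) : CStarInverseLimit A where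
  Δ := L.Δ
  obj δ := L.closureRange δ
  map {δ ε} h := NonUnitalStarAlgHom.codRestrict
    ((L.map h).comp (NonUnitalStarSubalgebraClass.subtype (L.closureRange ε))) (L.closureRange δ)
    fun x => L.map_mem_closureRange h x.2
  map_refl δ x := Subtype.ext (L.map_refl δ x)
  map_map h k x := Subtype.ext (L.map_map h k x)
  proj δ := NonUnitalStarAlgHom.codRestrict (L.proj δ) (L.closureRange δ) (L.proj_mem_closureRange δ)
  map_proj h a := Subtype.ext (L.map_proj h a)
  existsUnique_lift x hx := by
    obtain ⟨a, ha, huniq⟩ := L.existsUnique_lift (fun δ => (x δ : L.obj δ))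
      fun h => congrArg Subtype.val (hx h)
    exact ⟨a, fun δ => Subtype.ext (ha δ),
      fun b hb => huniq b fun δ => congrArg Subtype.val (hb δ)⟩
  isInducing := by
    refine IsInducing.of_comp (g := fun (x : ∀ δ, L.closureRange δ) δ => (x δ : L.obj δ))
      ?_ ?_ L.isInducing
    · exact continuous_pi fun δ => (L.continuous_proj δ).subtype_mk _
    · exact continuous_pi fun δ => continuous_subtype_val.comp (continuous_apply δ)

end CStarInverseLimit

/-! ### Inverse limits of group actions -/

section InverseLimitGroupActions

variable {G : Type v} [Group G] [TopologicalSpace G] [IsTopologicalGroup G]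
variable {A : Type u} [NonUnitalRing A] [StarRing A] [Module ℂ A] [UniformSpace A]
  [IsLocallyCStarAlgebra A]

omit [TopologicalSpace G] [IsTopologicalGroup G] in
theorem GroupAction.IsInverseLimit.hasInvariantSeminorms {β : GroupAction G A}
    (h : β.IsInverseLimit) : β.HasInvariantSeminorms := by
  obtain ⟨L, βd, -, hproj⟩ := h
  intro p hp
  obtain ⟨δ, C, hC0, hC⟩ := L.exists_le_norm_proj hp.2
  refine ⟨L.projSeminorm δ, L.projSeminorm_mem δ, ⟨C, hC0, hC⟩, fun t a => ?_⟩
  rw [L.projSeminorm_apply, hproj, (βd δ).norm_apply, L.projSeminorm_apply]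

/-- The restriction to the closure of `proj δ A` of an action `γ` on `obj δ` that is intertwined with
an action `β` on `A`. -/
noncomputable def CStarInverseLimit.restrictAction (L : CStarInverseLimit A) {δ : L.Δ}
    (β : GroupAction G A) (γ : GroupAction G (L.obj δ))
    (h : ∀ t a, L.proj δ (β.toHom t a) = γ.toHom t (L.proj δ a)) :
    GroupAction G (L.closureRange δ) :=
  GroupAction.ofEnd
    (fun t => NonUnitalStarAlgHom.codRestrict
      ((γ.toHom t : L.obj δ →⋆ₙₐ[ℂ] L.obj δ).comp
        (NonUnitalStarSubalgebraClass.subtype (L.closureRange δ)))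
      (L.closureRange δ)
      fun x => L.apply_mem_closureRange (γ.continuous_apply t)
        (fun a => by rw [← h]; exact L.proj_mem_closureRange δ _) x.2)
    (fun x => Subtype.ext (γ.one_apply x.1))
    (fun s t x => Subtype.ext (γ.mul_apply s t x.1))
    (fun t => ((γ.continuous_apply t).comp continuous_subtype_val).subtype_mk _)

omit [IsTopologicalGroup G] [IsLocallyCStarAlgebra A] in
theorem CStarInverseLimit.restrictAction_isContinuous (L : CStarInverseLimit A) {δ : L.Δ}
    {β : GroupAction G A} (hβ : β.IsContinuous) (γ : GroupAction G (L.obj δ))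
    (h : ∀ t a, L.proj δ (β.toHom t a) = γ.toHom t (L.proj δ a)) :
    (L.restrictAction β γ h).IsContinuous := by
  refine GroupAction.isContinuous_of_dense _
    (D := {x : L.closureRange δ | (x : L.obj δ) ∈ Set.range (L.proj δ)}) (fun x => ?_) ?_
  · rw [closure_subtype]
    refine closure_mono ?_ x.2
    rintro _ ⟨a, rfl⟩
    exact ⟨⟨L.proj δ a, L.proj_mem_closureRange δ a⟩, ⟨a, rfl⟩, rfl⟩
  · rintro x ⟨a, ha⟩
    rw [continuous_induced_rng]
    refine ((L.continuous_proj δ).comp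
      (hβ.comp (continuous_id.prodMk (continuous_const (y := a))))).congr fun t => ?_
    change L.proj δ (β.toHom t a) = γ.toHom t x
    rw [h, ha]

theorem GroupAction.IsInverseLimit.toKacAction {β : GroupAction G A} (h : β.IsInverseLimit)
    (hc : β.IsContinuous) : (β.toKacAction hc h.hasInvariantSeminorms).IsInverseLimit := by
  obtain ⟨L, βd, hmap, hproj⟩ := h
  let αd : ∀ δ, KacAction G (L.closureRange δ) := fun δ =>
    (L.restrictAction β (βd δ) (hproj δ)).toKacAction (L.restrictAction_isContinuous hc _ _)
      (GroupAction.hasInvariantSeminorms_of_cstar _)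
  refine ⟨L.closure, αd, ?_, ?_⟩
  · exact fun h x t => Subtype.ext (hmap h t⁻¹ x.1)
  · exact fun δ a t => Subtype.ext (hproj δ t⁻¹ a)

end InverseLimitGroupActions

theorem proposition4p4 {G : Type v} [Group G] [TopologicalSpace G] [IsTopologicalGroup G]
    [LocallyCompactSpace G]
    {A : Type u} [NonUnitalRing A] [StarRing A] [Module ℂ A] [UniformSpace A]
    [IsLocallyCStarAlgebra A] :
    ∃ S : {α : KacAction G A // α.IsInverseLimit} →
        {β : GroupAction G A // β.IsContinuous ∧ β.IsInverseLimit},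
      (∀ α t a, (S α).1.toHom t a = α.1.toHom a t⁻¹) ∧ Function.Bijective S := by
  refine ⟨fun α => ⟨α.1.toGroupAction, α.1.toGroupAction_isContinuous, α.2.toGroupAction⟩,
    fun _ _ _ => rfl, fun α γ h => Subtype.ext (KacAction.ext_apply fun a t => ?_), ?_⟩
  · have := congrArg (fun β => β.1.toHom t⁻¹ a) h
    simpa only [KacAction.toGroupAction_apply, inv_inv] using this
  · rintro ⟨β, hc, hβ⟩
    refine ⟨⟨_, hβ.toKacAction hc⟩, Subtype.ext (GroupAction.ext_apply fun t a => ?_)⟩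
    simp
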